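/- Let $\Theta\subseteq\mathbb R^m$ be open, $L>0$, and let $f:\mathbb R^n\times\Theta\to\mathbb R$ be $C^2$, with $\nabla_x f$ $L$-Lipschitz in $x$ and in $\theta$, such that for every $\theta\in\Theta$ the function $f(\cdot,\theta)$ is level bounded and strongly convex; let $x^\star(\theta)$ be its minimizer and $X^\star(\theta)=(x^\star(\theta),x^\star(\theta))\in\mathbb R^{2n}$. Let $a_k,b_k\in[0,1]$ and $\gamma_k\in(0,2/L)$, let $X_0:\Theta\to\mathbb R^{2n}$ be $C^1$, and let $X_k=(x_k,x_{k-1})$ be generated by the inertial method $$x_{k+1}(\theta)=x_k+a_k(x_k-x_{k-1})-\gamma_k\nabla_x f\big(x_k+b_k(x_k-x_{k-1}),\theta\big),\qquad k\ge 0 .$$ Assume: (B) there is $\tau_0>0$ such that for every $k$ one of the following holds: $a_k<\frac{\gamma_kL}{2}b_k$ and $\tau_0<(1+a_k)-\frac{\gamma_kL}{2}(1+b_k)^2$; or ($b_k\le a_k$ or $\frac{\gamma_kL}{2}b_k\le a_k<b_k$) and $\tau_0<(1-3a_k)-\frac{\gamma_kL}{2}(1-b_k)^2$; (C.1) $a_k\to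 a\in[0,1]$, $b_k\to b\in[0,1]$, $\gamma_k\to\gamma\in(0,2/L)$. Fix $\theta\in\Theta$, write $H=\nabla_x^2f(x^\star(\theta),\theta)$, and assume (C.2) if $a,b\in[0,1)$, then $\frac{2(b-a)-1}{1+2b}$ is strictly less than the smallest eigenvalue of $\mathrm{Id}-\gamma H$. Let $$M=\begin{pmatrix}(1+a)\mathrm{Id}-\gamma(1+b)H & -a\,\mathrm{Id}+\gamma bH\\ \mathrm{Id}&0\end{pmatrix},$$ let $\rho(M)$ be its spectral radius (the largest modulus of a complex eigenvalue), $\tau=2\rho(M)$, and $g(X_k)=2+\|\partial_\theta X_k(\theta)-\partial_\theta X^\star(\theta)\|$, where $\|\cdot\|$ is the operator norm of Jacobians for Euclidean norms. Then $x^\star(\theta)$ is the unique minimizer of $f(\cdot,\theta)$, $X^\star$ and all $X_k$ are differentiable at $\theta$, and for every $\varepsilon>0$ (in particular for every small one) there is $K\in\mathbb N$ such that for all $k\ge K$ $$\|\partial_\theta X_{k+1}(\theta)-\partial_\theta X^\star(\theta)\|\le\tau^{k+1-K}\,\|\partial_\theta X_K(\theta)-\partial_\theta X^\star(\theta)\|+\varepsilon\sum_{i=K}^{k}\tau^{\,i-K}g(X_i).$$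 -/

import Mathlib

open Filter Topology

/-- Euclidean space `ℝⁿ`. -/
abbrev Euc (n : ℕ) : Type := EuclideanSpace ℝ (Fin n)

/-- The doubled space `ℝⁿ × ℝⁿ = ℝ²ⁿ` with its Euclidean norm. -/
abbrev Euc2 (n : ℕ) : Type := WithLp 2 (Euc n × Euc n)

namespace InertialMethod

noncomputable section

/-- The partial gradient `∇ₓ f(x, θ)`. -/
def gradX {n m : ℕ} (f : Euc n → Euc m → ℝ) (x : Euc n) (θ : Euc m) : Euc n :=
  gradient (fun y => f y θ) x

/-- The partial Hessian `∇ₓ² f(x, θ)` as a linear operator on `ℝⁿ`. -/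
def hessX {n m : ℕ} (f : Euc n → Euc m → ℝ) (x : Euc n) (θ : Euc m) : Euc n →L[ℝ] Euc n :=
  fderiv ℝ (fun y => gradX f y θ) x

/-- The partial Hessian `∇ₓ² f(x, θ)` as a matrix. -/
def hessMatrix {n m : ℕ} (f : Euc n → Euc m → ℝ) (x : Euc n) (θ : Euc m) :
    Matrix (Fin n) (Fin n) ℝ :=
  Matrix.of fun i j => hessX f x θ (EuclideanSpace.single j 1) i

/-- `x⋆(θ)`, the minimizer of `x ↦ f(x, θ)` over `ℝⁿ` (an arbitrary point if there is none). -/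
def xStar {n m : ℕ} (f : Euc n → Euc m → ℝ) (θ : Euc m) : Euc n :=
  Classical.epsilon fun x => IsMinOn (fun y => f y θ) Set.univ x

/-- `X⋆(θ) = (x⋆(θ), x⋆(θ))`. -/
def XStar {n m : ℕ} (f : Euc n → Euc m → ℝ) (θ : Euc m) : Euc2 n :=
  WithLp.toLp 2 (xStar f θ, xStar f θ)

/-- One step of the inertial method with inertial parameters `a`, `b` and step size `γ`:
`(x, z) ↦ (x + a (x - z) - γ ∇ₓ f(x + b (x - z), θ), x)`. -/
def step {n m : ℕ} (f : Euc n → Euc m → ℝ) (a b γ : ℝ) (X : Euc2 n) (θ : Euc m) : Euc2 n :=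
  WithLp.toLp 2
    (X.fst + a • (X.fst - X.snd) - γ • gradX f (X.fst + b • (X.fst - X.snd)) θ, X.fst)

/-- The iterates `X_k(θ) = (x_k(θ), x_{k-1}(θ))`, started at `X₀(θ)`. -/
def iter {n m : ℕ} (f : Euc n → Euc m → ℝ) (a b γ : ℕ → ℝ) (X₀ : Euc m → Euc2 n) :
    ℕ → Euc m → Euc2 n
  | 0 => X₀
  | k + 1 => fun θ => step f (a k) (b k) (γ k) (iter f a b γ X₀ k θ) θ

/-- The block matrix
`M = [[(1 + a) Id - γ (1 + b) H, -a Id + γ b H], [Id, 0]]` with `H = ∇ₓ² f(x⋆(θ), θ)`. -/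
def limitMatrix {n m : ℕ} (f : Euc n → Euc m → ℝ) (a b γ : ℝ) (θ : Euc m) :
    Matrix (Fin n ⊕ Fin n) (Fin n ⊕ Fin n) ℝ :=
  Matrix.fromBlocks
    ((1 + a) • (1 : Matrix (Fin n) (Fin n) ℝ) - (γ * (1 + b)) • hessMatrix f (xStar f θ) θ)
    (-(a • (1 : Matrix (Fin n) (Fin n) ℝ)) + (γ * b) • hessMatrix f (xStar f θ) θ)
    1 0

/-- The spectral radius of a real square matrix: the largest modulus of its complex eigenvalues. -/
def specRadius {ι : Type*} [Fintype ι] [DecidableEq ι] (A : Matrix ι ι ℝ) : ℝ :=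
  (spectralRadius ℂ (A.map (algebraMap ℝ ℂ))).toReal

/-- The smallest (real) eigenvalue of an operator, used for symmetric operators. -/
def smallestEigenvalue {n : ℕ} (T : Euc n →L[ℝ] Euc n) : ℝ :=
  sInf {η : ℝ | Module.End.HasEigenvalue (T : Module.End ℝ (Euc n)) η}

/-- The operator `G_θ = Id - γ ∇ₓ² f(x⋆(θ), θ)`. -/
def opG {n m : ℕ} (f : Euc n → Euc m → ℝ) (γ : ℝ) (θ : Euc m) : Euc n →L[ℝ] Euc n :=
  ContinuousLinearMap.id ℝ (Euc n) - γ • hessX f (xStar f θ) θ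

/-- Assumptions on the objective: `f` is `C²` on `ℝⁿ × Θ`, its gradient in `x` is
`L`-Lipschitz in `x` and in `θ`, and every `f(·, θ)` is level bounded. -/
structure SmoothObjective {n m : ℕ} (f : Euc n → Euc m → ℝ) (Θ : Set (Euc m)) (L : ℝ) :
    Prop where
  contDiffOn : ContDiffOn ℝ 2 (fun p : Euc n × Euc m => f p.1 p.2) (Set.univ ×ˢ Θ)
  lipschitz_x : ∀ θ ∈ Θ, ∀ x y : Euc n, ‖gradX f x θ - gradX f y θ‖ ≤ L * ‖x - y‖
  lipschitz_theta : ∀ x : Euc n, ∀ θ ∈ Θ, ∀ θ' ∈ Θ,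
    ‖gradX f x θ - gradX f x θ'‖ ≤ L * ‖θ - θ'‖
  levelBounded : ∀ θ ∈ Θ, ∀ c : ℝ, Bornology.IsBounded {x : Euc n | f x θ ≤ c}

/-- The admissible range of the parameters of the inertial method. -/
structure AdmissibleParams (a b γ : ℕ → ℝ) (L : ℝ) : Prop where
  a_mem : ∀ k, a k ∈ Set.Icc (0 : ℝ) 1
  b_mem : ∀ k, b k ∈ Set.Icc (0 : ℝ) 1
  γ_mem : ∀ k, γ k ∈ Set.Ioo (0 : ℝ) (2 / L)

/-- The two-case condition on the parameters that yields global convergence of the iterates. -/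
def GlobalCondition (a b γ : ℕ → ℝ) (L : ℝ) : Prop :=
  ∃ τ > 0, ∀ k,
    (a k < γ k * L / 2 * b k ∧ τ < (1 + a k) - γ k * L / 2 * (1 + b k) ^ 2) ∨
    ((b k ≤ a k ∨ (γ k * L / 2 * b k ≤ a k ∧ a k < b k)) ∧
      τ < (1 - 3 * a k) - γ k * L / 2 * (1 - b k) ^ 2)

/-- The parameters converge to admissible limits `a∞`, `b∞`, `γ∞`. -/
structure ParamLimits (a b γ : ℕ → ℝ) (L a' b' γ' : ℝ) : Prop where
  a_mem : a' ∈ Set.Icc (0 : ℝ) 1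
  b_mem : b' ∈ Set.Icc (0 : ℝ) 1
  γ_mem : γ' ∈ Set.Ioo (0 : ℝ) (2 / L)
  a_tendsto : Tendsto a atTop (𝓝 a')
  b_tendsto : Tendsto b atTop (𝓝 b')
  γ_tendsto : Tendsto γ atTop (𝓝 γ')

end

end InertialMethod

/-! The summand `i = K` on the right-hand side is at least 2, so the right-hand side is at least 2ε
for every `k ≥ K`; the factor `τ` enters only through `τ ≥ 0`. It therefore suffices that the
derivatives of the iterates converge to the derivative of the solution map (`tendsto_fderiv_iter`).

Subtracting the differentiated fixed-point equation (`fderiv_XStar_eq`) from the differentiated step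
gives a linear recursion for the derivative error. Its coefficients converge, and its forcing
vanishes, as soon as the iterates themselves converge. Such a recursion tends to zero once the limit
operator has a power of norm below 1 (`tendsto_zero_of_linear_recursion`).

Convergence of the iterates and contractivity of the limit operator come from the same Lyapunov
argument, `inertial_tendsto_zero`, for an inertial method driven by a cocoercive, strongly monotone
field. It is applied once to the gradient, and once to the Hessian at the minimizer, which inherits
both properties (`cocoercive_fderiv`). The parameter condition it needs is the limit of the two
cases of the global condition, written as one inequality (`GlobalCondition.limit_pos`). -/

namespace InertialMethod

/-! ### Lyapunov analysis of inertial methods -/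

section Dynamics

/-- `W` may be negative, but since `α < 1` its monotonicity bounds `u`, which in turn bounds `W`
from below. So `W` converges, and its decrements, which dominate `ρ u`, vanish. -/
theorem tendsto_zero_of_lyapunov {u W : ℕ → ℝ} {α ρ : ℝ} (hα₀ : 0 ≤ α) (hα₁ : α < 1)
    (hρ : 0 < ρ) (hu : ∀ k, 0 ≤ u k) (hW : ∀ k, W (k + 1) ≤ W k - ρ * u k)
    (hle : ∀ k, u (k + 1) ≤ α * u k + W (k + 1)) : Tendsto u atTop (𝓝 0) := by
  have hanti : Antitone W := antitone_nat_of_succ_le fun k => by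
    nlinarith [hW k, hu k]
  obtain ⟨B, hB⟩ : ∃ B, ∀ k, u k ≤ B := by
    -- `W 0 / (1 - α)` is the fixed point of `t ↦ α t + W 0`.
    refine ⟨max (u 0) (W 0 / (1 - α)), fun k => ?_⟩
    induction k with
    | zero => exact le_max_left _ _
    | succ k ih =>
      have h1 := hle k
      have h2 := hanti (Nat.zero_le (k + 1))
      have h3 : W 0 ≤ (1 - α) * max (u 0) (W 0 / (1 - α)) := by
        have := le_max_right (u 0) (W 0 / (1 - α))
        rw [div_le_iff₀ (by linarith)] at this
        linarith
      nlinarith [mul_le_mul_of_nonneg_left ih hα₀]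
  have hbdd : BddBelow (Set.range W) := by
    refine ⟨-(α * B), ?_⟩
    rintro _ ⟨k, rfl⟩
    nlinarith [hle k, hu (k + 1), mul_le_mul_of_nonneg_left (hB k) hα₀, hanti (Nat.le_succ k)]
  have hlim := tendsto_atTop_ciInf hanti hbdd
  have hdiff : Tendsto (fun k => (W k - W (k + 1)) / ρ) atTop (𝓝 0) := by
    simpa using (hlim.sub ((tendsto_add_atTop_iff_nat 1).2 hlim)).div_const ρ
  refine squeeze_zero hu (fun k => ?_) hdiff
  rw [le_div_iff₀ hρ]
  linarith [hW k]

variable {E : Type*} [NormedAddCommGroup E] [InnerProductSpace ℝ E]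

/-- Expanding the square leaves a cross term between the old difference `x - w` and the new one `a •
(x - w) - γ • g`. Young's inequality splits it, which produces the absolute values. -/
theorem inertial_step_le {x w g : E} {a b γ κ ν : ℝ} (hγ : 0 ≤ γ) (hκ : 0 < κ)
    (h : ‖g‖ ^ 2 + κ * ν * ‖x + b • (x - w)‖ ^ 2 ≤ κ * inner ℝ (x + b • (x - w)) g) :
    ‖x + a • (x - w) - γ • g‖ ^ 2 ≤ ‖x‖ ^ 2 + a * (‖x‖ ^ 2 - ‖w‖ ^ 2)
      + (a + γ * κ / 2 * b ^ 2 + |a - γ * κ / 2 * b|) * ‖x - w‖ ^ 2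
      - (1 - γ * κ / 2 - |a - γ * κ / 2 * b|) * ‖a • (x - w) - γ • g‖ ^ 2
      - 2 * γ * ν * ‖x + b • (x - w)‖ ^ 2 := by
  obtain ⟨d, rfl⟩ : ∃ d, w = x - d := ⟨x - w, by abel⟩
  simp only [sub_sub_cancel] at h ⊢
  have h1 : 2 * (a - γ * κ / 2 * b) * inner ℝ (a • d - γ • g) d ≤
      |a - γ * κ / 2 * b| * (‖a • d - γ • g‖ ^ 2 + ‖d‖ ^ 2) := by
    have h2 : 2 * |inner ℝ (a • d - γ • g) d| ≤ ‖a • d - γ • g‖ ^ 2 + ‖d‖ ^ 2 := by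
      nlinarith [abs_real_inner_le_norm (a • d - γ • g) d, sq_nonneg (‖a • d - γ • g‖ - ‖d‖)]
    calc _ ≤ |2 * (a - γ * κ / 2 * b) * inner ℝ (a • d - γ • g) d| := le_abs_self _
      _ = |a - γ * κ / 2 * b| * (2 * |inner ℝ (a • d - γ • g) d|) := by
        rw [abs_mul, abs_mul, abs_two]; ring
      _ ≤ _ := mul_le_mul_of_nonneg_left h2 (abs_nonneg _)
  -- The scaled slack of `h` and the square in `h4` are the two nonnegative terms whose sum is the
  -- gap in `key`.
  have h3 : 0 ≤ 2 * γ / κ * (κ * inner ℝ (x + b • d) g - ‖g‖ ^ 2 - κ * ν * ‖x + b • d‖ ^ 2) :=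
    mul_nonneg (by positivity) (by linarith)
  have h4 : 0 ≤ γ * κ / 2 * ‖(a • d - γ • g) - b • d + (2 / κ) • g‖ ^ 2 := by positivity
  have key : ‖x‖ ^ 2 + a * (‖x‖ ^ 2 - ‖x - d‖ ^ 2) + (a + γ * κ / 2 * b ^ 2) * ‖d‖ ^ 2
      + 2 * (a - γ * κ / 2 * b) * inner ℝ (a • d - γ • g) d
      - (1 - γ * κ / 2) * ‖a • d - γ • g‖ ^ 2 - 2 * γ * ν * ‖x + b • d‖ ^ 2
      - ‖x + a • d - γ • g‖ ^ 2 =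
      2 * γ / κ * (κ * inner ℝ (x + b • d) g - ‖g‖ ^ 2 - κ * ν * ‖x + b • d‖ ^ 2)
      + γ * κ / 2 * ‖(a • d - γ • g) - b • d + (2 / κ) • g‖ ^ 2 := by
    simp only [← real_inner_self_eq_norm_sq, inner_add_left, inner_add_right, inner_sub_left,
      inner_sub_right, real_inner_smul_left, real_inner_smul_right, real_inner_comm x d,
      real_inner_comm x g, real_inner_comm d g]
    field_simp
    ring
  nlinarith

/-- Trades decay at the extrapolated point for decay at `x`, at the price of a multiple of `‖x - w‖
^ 2` that the weight `R` of the Lyapunov function absorbs. -/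
theorem half_norm_sq_sub_le (x w : E) {b : ℝ} (hb : b ∈ Set.Icc (0 : ℝ) 1) :
    ‖x‖ ^ 2 / 2 - ‖x - w‖ ^ 2 ≤ ‖x + b • (x - w)‖ ^ 2 := by
  have h1 : ‖x‖ ≤ ‖x + b • (x - w)‖ + ‖x - w‖ := by
    calc ‖x‖ = ‖(x + b • (x - w)) - b • (x - w)‖ := by congr 1; abel
      _ ≤ ‖x + b • (x - w)‖ + ‖b • (x - w)‖ := norm_sub_le _ _
      _ ≤ _ := by
        gcongr
        rw [norm_smul, Real.norm_of_nonneg hb.1]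
        exact mul_le_of_le_one_left (norm_nonneg _) hb.2
  nlinarith [norm_nonneg x, sq_nonneg (‖x + b • (x - w)‖ - ‖x - w‖), norm_nonneg (x - w)]

/-- The weight `R` must dominate the coefficient of the old squared difference and be dominated by
that of the new one. Of the decay `σ / 2` on `‖x‖ ^ 2`, one eighth of `σ` pays for replacing `a` by
`a'` and another for the shift `a' - σ / 8`; this leaves `σ / 4`. -/
theorem inertial_lyapunov_le {x w g : E} {a b γ a' κ ν R σ : ℝ} (hγ : 0 ≤ γ) (hκ : 0 < κ)
    (hν : 0 ≤ ν) (hb : b ∈ Set.Icc (0 : ℝ) 1)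
    (hP : a + γ * κ / 2 * b ^ 2 + |a - γ * κ / 2 * b| + 2 * γ * ν ≤ R)
    (hQ : R ≤ 1 - γ * κ / 2 - |a - γ * κ / 2 * b|) (hσ : σ / 2 ≤ γ * ν) (ha : |a - a'| ≤ σ / 8)
    (h : ‖g‖ ^ 2 + κ * ν * ‖x + b • (x - w)‖ ^ 2 ≤ κ * inner ℝ (x + b • (x - w)) g) :
    ‖x + a • (x - w) - γ • g‖ ^ 2 - (a' - σ / 8) * ‖x‖ ^ 2
      + R * ‖a • (x - w) - γ • g‖ ^ 2 ≤
      ‖x‖ ^ 2 - (a' - σ / 8) * ‖w‖ ^ 2 + R * ‖x - w‖ ^ 2 - σ / 4 * ‖x‖ ^ 2 := by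
  have h6 := inertial_step_le (a := a) hγ hκ h
  have h12 := mul_le_mul_of_nonneg_left (half_norm_sq_sub_le x w hb)
    (by positivity : 0 ≤ 2 * γ * ν)
  have h13 := mul_le_mul_of_nonneg_right hP (sq_nonneg ‖x - w‖)
  have h14 := mul_le_mul_of_nonneg_right hQ (sq_nonneg ‖a • (x - w) - γ • g‖)
  have h15 := mul_le_mul_of_nonneg_right hσ (sq_nonneg ‖x‖)
  obtain ⟨h10, h11⟩ := abs_le.1 ha
  have h16 := mul_le_mul_of_nonneg_right h11 (sq_nonneg ‖x‖)
  have h17 := mul_le_mul_of_nonneg_right h10 (sq_nonneg ‖w‖)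
  generalize ‖x + a • (x - w) - γ • g‖ ^ 2 = X' at *
  generalize ‖a • (x - w) - γ • g‖ ^ 2 = D' at *
  generalize ‖x + b • (x - w)‖ ^ 2 = Y at *
  generalize ‖x - w‖ ^ 2 = D at *
  generalize ‖x‖ ^ 2 = X at *
  generalize ‖w‖ ^ 2 = W at *
  generalize |a - γ * κ / 2 * b| = A at *
  linarith

/-- An inertial gradient method driven by a strongly monotone, cocoercive field `g` that vanishes
at `0` converges to `0`. -/
theorem inertial_tendsto_zero {x w g : ℕ → E} {a b γ : ℕ → ℝ} {a' b' γ' L μ : ℝ}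
    (hL : 0 < L) (hμ : 0 < μ) (hb : ∀ k, b k ∈ Set.Icc (0 : ℝ) 1) (hγ : ∀ k, 0 ≤ γ k)
    (ha' : 0 ≤ a') (hγ' : 0 < γ')
    (hta : Tendsto a atTop (𝓝 a')) (htb : Tendsto b atTop (𝓝 b')) (htγ : Tendsto γ atTop (𝓝 γ'))
    (hcond : 0 < 1 - γ' * L / 2 - a' - γ' * L / 2 * b' ^ 2 - 2 * |a' - γ' * L / 2 * b'|)
    (hw : ∀ k, w (k + 1) = x k)
    (hx : ∀ k, x (k + 1) = x k + a k • (x k - w k) - γ k • g k)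
    (hco : ∀ k, ‖g k‖ ^ 2 ≤ L * inner ℝ (x k + b k • (x k - w k)) (g k))
    (hmono : ∀ k, μ * ‖x k + b k • (x k - w k)‖ ^ 2 ≤
      inner ℝ (x k + b k • (x k - w k)) (g k)) :
    Tendsto x atTop (𝓝 0) := by
  -- Enlarging `L` slightly to `κ` keeps the strict condition and leaves a surplus `(κ - L) ⟨y, g⟩`,
  -- which strong monotonicity turns into the term `κ ν ‖y‖ ^ 2`.
  obtain ⟨κ, hκL, hκ⟩ : ∃ κ > L,
      0 < 1 - γ' * κ / 2 - a' - γ' * κ / 2 * b' ^ 2 - 2 * |a' - γ' * κ / 2 * b'| := by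
    have hc : Continuous fun κ : ℝ =>
        1 - γ' * κ / 2 - a' - γ' * κ / 2 * b' ^ 2 - 2 * |a' - γ' * κ / 2 * b'| := by fun_prop
    have h1 := (hc.tendsto L).eventually (lt_mem_nhds hcond)
    have h2 : ∀ᶠ κ in 𝓝[>] L, κ > L := self_mem_nhdsWithin
    exact (h2.and (h1.filter_mono nhdsWithin_le_nhds)).exists
  have hκ0 : 0 < κ := hL.trans hκL
  set P : ℝ := a' + γ' * κ / 2 * b' ^ 2 + |a' - γ' * κ / 2 * b'| with hP
  set Q : ℝ := 1 - γ' * κ / 2 - |a' - γ' * κ / 2 * b'| with hQ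
  have hPQ : P < Q := by rw [hP, hQ]; linarith
  have hP0 : 0 ≤ P := by rw [hP]; positivity
  have hν₀ : 0 < (1 - L / κ) * μ :=
    mul_pos (by rw [sub_pos, div_lt_one hκ0]; exact hκL) hμ
  obtain ⟨ν, hν, hνle, hνP⟩ : ∃ ν > 0, ν ≤ (1 - L / κ) * μ ∧ P + 2 * γ' * ν < Q := by
    refine ⟨min ((1 - L / κ) * μ) ((Q - P) / (4 * γ')), lt_min hν₀ ?_, min_le_left _ _, ?_⟩
    · exact div_pos (by linarith) (by linarith)
    · have h := min_le_right ((1 - L / κ) * μ) ((Q - P) / (4 * γ'))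
      rw [le_div_iff₀ (by linarith)] at h
      nlinarith
  obtain ⟨R, hR1, hR2⟩ := exists_between hνP
  have hR : 0 ≤ R := hP0.trans (by nlinarith)
  have hP' : ∀ᶠ k in atTop,
      a k + γ k * κ / 2 * b k ^ 2 + |a k - γ k * κ / 2 * b k| + 2 * γ k * ν < R := by
    have hc := ((hta.add (((htγ.mul_const κ).div_const 2).mul (htb.pow 2))).add
      (hta.sub (((htγ.mul_const κ).div_const 2).mul htb)).abs).add
      ((htγ.const_mul 2).mul_const ν)
    exact hc.eventually (gt_mem_nhds hR1)
  have hQ' : ∀ᶠ k in atTop, R < 1 - γ k * κ / 2 - |a k - γ k * κ / 2 * b k| := by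
    have hc := ((((htγ.mul_const κ).div_const 2).const_sub 1).sub
      (hta.sub (((htγ.mul_const κ).div_const 2).mul htb)).abs)
    exact hc.eventually (lt_mem_nhds hR2)
  have hσ : 0 < γ' * ν := by positivity
  have hσ' : ∀ᶠ k in atTop, γ' * ν / 2 < γ k * ν :=
    (htγ.mul_const ν).eventually (lt_mem_nhds (by linarith))
  have hη : ∀ᶠ k in atTop, |a k - a'| < γ' * ν / 8 := by
    have : Tendsto (fun k => |a k - a'|) atTop (𝓝 |a' - a'|) := (hta.sub_const a').abs
    rw [sub_self, abs_zero] at this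
    exact this.eventually (gt_mem_nhds (by linarith))
  obtain ⟨N, hN⟩ := eventually_atTop.1 (hP'.and (hQ'.and (hσ'.and hη)))
  have ha'1 : a' < 1 := by
    have h1 : 0 ≤ γ' * L / 2 := by positivity
    nlinarith [abs_nonneg (a' - γ' * L / 2 * b'), mul_nonneg h1 (sq_nonneg b')]
  have hstep : ∀ k ≥ N, ‖x (k + 1)‖ ^ 2 - (a' - γ' * ν / 8) * ‖x k‖ ^ 2
      + R * ‖x (k + 1) - x k‖ ^ 2 ≤
      ‖x k‖ ^ 2 - (a' - γ' * ν / 8) * ‖w k‖ ^ 2 + R * ‖x k - w k‖ ^ 2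
        - γ' * ν / 4 * ‖x k‖ ^ 2 := by
    intro k hk
    obtain ⟨h1, h2, h3, h4⟩ := hN k hk
    set y := x k + b k • (x k - w k) with hy
    have h5 : ‖g k‖ ^ 2 + κ * ν * ‖y‖ ^ 2 ≤ κ * inner ℝ y (g k) := by
      have e1 : κ * ((1 - L / κ) * μ) = (κ - L) * μ := by field_simp
      have e2 : κ * ν ≤ (κ - L) * μ := by rw [← e1]; gcongr
      nlinarith [hco k, mul_le_mul_of_nonneg_left (hmono k) (sub_nonneg.2 hκL.le),
        mul_le_mul_of_nonneg_right e2 (sq_nonneg ‖y‖)]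
    have h8 : x (k + 1) - x k = a k • (x k - w k) - γ k • g k := by
      rw [hx k, add_sub_assoc, add_sub_cancel_left]
    rw [h8, hx k]
    exact inertial_lyapunov_le (hγ k) hκ0 hν.le (hb k) h1.le h2.le h3.le h4.le h5
  have hlim : Tendsto (fun k => ‖x (k + N)‖ ^ 2) atTop (𝓝 0) := by
    refine tendsto_zero_of_lyapunov (α := a') (ρ := γ' * ν / 4) (W := fun k =>
      ‖x (k + N)‖ ^ 2 - (a' - γ' * ν / 8) * ‖w (k + N)‖ ^ 2 + R * ‖x (k + N) - w (k + N)‖ ^ 2)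
      -- With `α = a'`, the difference `α u k + W (k + 1) - u (k + 1)` is `γ' ν / 8` times `u k`
      -- plus the `R` term, hence nonnegative.
      ha' ha'1 (by linarith) (fun k => sq_nonneg _) (fun k => ?_) (fun k => ?_)
    · have := hstep (k + N) (by omega)
      simpa only [add_right_comm k 1 N, hw (k + N)] using this
    · simp only [add_right_comm k 1 N, hw (k + N)]
      nlinarith [mul_nonneg hR (sq_nonneg ‖x (k + N + 1) - x (k + N)‖),
        mul_nonneg hσ.le (sq_nonneg ‖x (k + N)‖)]
  rw [← tendsto_add_atTop_iff_nat N, tendsto_zero_iff_norm_tendsto_zero]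
  have := hlim.sqrt
  simpa using this

end Dynamics

/-! ### Perturbed linear recursions -/

section LinearRecursion

theorem tendsto_zero_of_contraction {u δ : ℕ → ℝ} {r : ℝ} (hr₀ : 0 ≤ r) (hr₁ : r < 1)
    (hu : ∀ k, 0 ≤ u k) (hδ : Tendsto δ atTop (𝓝 0))
    (h : ∀ᶠ k in atTop, u (k + 1) ≤ r * u k + δ k) : Tendsto u atTop (𝓝 0) := by
  rw [Metric.tendsto_atTop]
  intro ε hε
  have h1 : ∀ᶠ k in atTop, δ k < (1 - r) * (ε / 2) :=
    hδ.eventually (gt_mem_nhds (mul_pos (by linarith) (by linarith)))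
  obtain ⟨N, hN⟩ := eventually_atTop.1 (h.and h1)
  have h2 : ∀ j, u (N + j) - ε / 2 ≤ r ^ j * |u N - ε / 2| := by
    intro j
    induction j with
    | zero => simpa using le_abs_self (u N - ε / 2)
    | succ j ih =>
      obtain ⟨h3, h4⟩ := hN (N + j) (by omega)
      rw [← add_assoc, pow_succ]
      nlinarith [mul_le_mul_of_nonneg_left ih hr₀]
  have h3 : Tendsto (fun j => r ^ j * |u N - ε / 2|) atTop (𝓝 0) := by
    simpa using (tendsto_pow_atTop_nhds_zero_of_lt_one hr₀ hr₁).mul_const |u N - ε / 2|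
  obtain ⟨M, hM⟩ := eventually_atTop.1 (h3.eventually (gt_mem_nhds (half_pos hε)))
  refine ⟨N + M, fun k hk => ?_⟩
  obtain ⟨j, rfl⟩ := Nat.exists_eq_add_of_le (show N ≤ k by omega)
  rw [Real.dist_eq, sub_zero, abs_of_nonneg (hu _)]
  linarith [h2 j, hM j (by omega)]

variable {E F : Type*} [NormedAddCommGroup E] [NormedSpace ℝ E] [NormedAddCommGroup F]
  [NormedSpace ℝ F]

/-- A linear recursion whose coefficients converge to an operator with a contractive power, and
whose inhomogeneity vanishes asymptotically, converges to zero. -/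
theorem tendsto_zero_of_linear_recursion {T : ℕ → E →L[ℝ] E} {T' : E →L[ℝ] E}
    {D e : ℕ → F →L[ℝ] E} (hT : Tendsto T atTop (𝓝 T')) {p : ℕ} (hp₀ : 0 < p) (hp : ‖T' ^ p‖ < 1)
    (he : Tendsto e atTop (𝓝 0)) (hD : ∀ k, D (k + 1) = (T k).comp (D k) + e k) :
    Tendsto D atTop (𝓝 0) := by
  set q := ‖T' ^ p‖
  -- Adapted norm: composing with `T'` telescopes the sum, losing `‖A‖` and gaining only `‖T' ^ p ∘
  -- A‖ ≤ q ‖A‖`, so a single application of `T'` already contracts `V`.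
  set V : (F →L[ℝ] E) → ℝ := fun A => ∑ i ∈ Finset.range p, ‖(T' ^ i).comp A‖ with hV
  set C : ℝ := 1 + ∑ i ∈ Finset.range p, ‖T' ^ i‖ with hC
  have hC1 : 1 ≤ C := by
    have : 0 ≤ ∑ i ∈ Finset.range p, ‖T' ^ i‖ := Finset.sum_nonneg fun _ _ => norm_nonneg _
    linarith
  have hV0 : ∀ A, 0 ≤ V A := fun A => Finset.sum_nonneg fun _ _ => norm_nonneg _
  have hVadd : ∀ A B, V (A + B) ≤ V A + V B := fun A B => by
    simp only [hV, ← Finset.sum_add_distrib, ContinuousLinearMap.comp_add]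
    exact Finset.sum_le_sum fun _ _ => norm_add_le _ _
  have hVle : ∀ A, V A ≤ C * ‖A‖ := fun A => by
    have h1 : V A ≤ ∑ i ∈ Finset.range p, ‖T' ^ i‖ * ‖A‖ :=
      Finset.sum_le_sum fun i _ => ContinuousLinearMap.opNorm_comp_le _ _
    rw [← Finset.sum_mul] at h1
    nlinarith [norm_nonneg A]
  have hVge : ∀ A, ‖A‖ ≤ V A := fun A => by
    have h1 := Finset.single_le_sum (f := fun i => ‖(T' ^ i).comp A‖)
      (fun _ _ => norm_nonneg _) (Finset.mem_range.2 hp₀)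
    simpa [ContinuousLinearMap.one_def] using h1
  have hVT : ∀ A, V (T'.comp A) ≤ (1 - (1 - q) / C) * V A := fun A => by
    have h1 : V (T'.comp A) + ‖A‖ = V A + ‖(T' ^ p).comp A‖ := by
      have h2 := (Finset.sum_range_succ' (fun i => ‖(T' ^ i).comp A‖) p).symm.trans
        (Finset.sum_range_succ (fun i => ‖(T' ^ i).comp A‖) p)
      rw [← h2]
      simp [hV, pow_succ, ContinuousLinearMap.one_def, ContinuousLinearMap.mul_def,
        ContinuousLinearMap.comp_assoc]
    have h3 : ‖(T' ^ p).comp A‖ ≤ q * ‖A‖ := ContinuousLinearMap.opNorm_comp_le _ _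
    have h4 : (1 - q) / C * V A ≤ (1 - q) * ‖A‖ := by
      rw [div_mul_eq_mul_div, div_le_iff₀ (by linarith)]
      nlinarith [mul_le_mul_of_nonneg_left (hVle A) (sub_nonneg.2 hp.le)]
    linarith
  have hq0 : 0 ≤ q := norm_nonneg _
  clear_value V C q
  set s := (1 - q) / C with hs
  have hs0 : 0 < s := div_pos (by linarith) (by linarith)
  have hs1 : s ≤ 1 := by rw [hs, div_le_one (by linarith)]; linarith
  have hTV : Tendsto (fun k => V (D k)) atTop (𝓝 0) := by
    have hδ : Tendsto (fun k => C * ‖e k‖) atTop (𝓝 0) := by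
      simpa using he.norm.const_mul C
    have hTn : Tendsto (fun k => C * ‖T k - T'‖) atTop (𝓝 0) := by
      simpa using (hT.sub_const T').norm.const_mul C
    -- Half of the contraction gain `s` is spent on the perturbation `T k - T'`.
    refine tendsto_zero_of_contraction (r := 1 - s / 2) (by linarith) (by linarith)
      (fun k => hV0 _) hδ ?_
    filter_upwards [hTn.eventually (gt_mem_nhds (half_pos hs0))] with k hk
    have h1 : D (k + 1) = T'.comp (D k) + ((T k - T').comp (D k) + e k) := by
      rw [hD k, ContinuousLinearMap.sub_comp]; abel
    have h2 : V ((T k - T').comp (D k)) ≤ s / 2 * V (D k) := by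
      calc V ((T k - T').comp (D k)) ≤ C * ‖(T k - T').comp (D k)‖ := hVle _
        _ ≤ C * (‖T k - T'‖ * ‖D k‖) := by
          gcongr
          exact ContinuousLinearMap.opNorm_comp_le _ _
        _ = C * ‖T k - T'‖ * ‖D k‖ := by ring
        _ ≤ s / 2 * V (D k) := by
          gcongr
          exact hVge _
    rw [h1]
    linarith [hVadd (T'.comp (D k)) ((T k - T').comp (D k) + e k),
      hVadd ((T k - T').comp (D k)) (e k), hVT (D k), hVle (e k)]
  exact squeeze_zero_norm (fun k => hVge _) hTV

/-- On a finite-dimensional space, an operator whose orbits all tend to zero has a contractive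
power. -/
theorem exists_norm_pow_lt_one [FiniteDimensional ℝ E] {T : E →L[ℝ] E}
    (h : ∀ z, Tendsto (fun k => (T ^ k) z) atTop (𝓝 0)) : ∃ p, 0 < p ∧ ‖T ^ p‖ < 1 := by
  let v := Module.finBasis ℝ E
  obtain ⟨C, hC, hv⟩ := v.exists_opNorm_le (F := E)
  -- Orbits of finitely many basis vectors control the operator norm, up to the factor `C`.
  have h1 : ∀ᶠ k in atTop, ∀ i, ‖(T ^ k) (v i)‖ < 1 / (2 * C) := by
    refine eventually_all.2 fun i => ?_
    have := (h (v i)).norm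
    rw [norm_zero] at this
    exact this.eventually (gt_mem_nhds (by positivity))
  obtain ⟨p, hp, hp0⟩ := (h1.and (eventually_gt_atTop 0)).exists
  refine ⟨p, hp0, ?_⟩
  have h2 := hv (u := T ^ p) (M := 1 / (2 * C)) (by positivity) (fun i => (hp i).le)
  have h3 : C * (1 / (2 * C)) = 1 / 2 := by field_simp
  linarith

end LinearRecursion

/-! ### Gradient inequalities for smooth convex functions -/

section ConvexAnalysis

variable {E : Type*} [NormedAddCommGroup E] [InnerProductSpace ℝ E] [CompleteSpace E]
  {F : E → ℝ} {g : E → E} {L μ : ℝ}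

theorem hasDerivAt_line (hg : ∀ x, HasGradientAt F (g x) x) (x v : E) (t : ℝ) :
    HasDerivAt (fun t : ℝ => F (x + t • v)) (inner ℝ (g (x + t • v)) v) t := by
  have h1 : HasDerivAt (fun t : ℝ => x + t • v) v t := by
    simpa using ((hasDerivAt_id t).smul_const v).const_add x
  simpa using! (hg (x + t • v)).hasFDerivAt.comp_hasDerivAt t h1

theorem strongConvexOn_le_of_hasGradientAt (hF : StrongConvexOn Set.univ μ F)
    (hg : ∀ x, HasGradientAt F (g x) x) (x y : E) :
    F x + inner ℝ (g x) (y - x) + μ / 2 * ‖y - x‖ ^ 2 ≤ F y := by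
  have h1 : Tendsto (fun t : ℝ => t⁻¹ • (F (x + t • (y - x)) - F x)) (𝓝[>] 0)
      (𝓝 (inner ℝ (g x) (y - x))) := by
    have h := (hasDerivAt_line hg x (y - x) 0).tendsto_slope_zero_right
    simpa using h
  have h2 : Tendsto (fun t : ℝ => F y - F x - (1 - t) * (μ / 2 * ‖y - x‖ ^ 2)) (𝓝[>] 0)
      (𝓝 (F y - F x - (1 - 0) * (μ / 2 * ‖y - x‖ ^ 2))) :=
    (Continuous.tendsto (by fun_prop) 0).mono_left nhdsWithin_le_nhds
  have h3 := le_of_tendsto_of_tendsto h1 h2 <| by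
    filter_upwards [Ioo_mem_nhdsGT (zero_lt_one (α := ℝ))] with t ht
    have h4 := hF.2 (Set.mem_univ x) (Set.mem_univ y) (sub_nonneg.2 ht.2.le) ht.1.le (by ring)
    rw [show (1 - t) • x + t • y = x + t • (y - x) by module, norm_sub_rev] at h4
    simp only [smul_eq_mul] at h4 ⊢
    rw [inv_mul_le_iff₀ ht.1]
    nlinarith
  linarith

/-- Along the segment, `F` minus its quadratic upper model has nonpositive derivative; monotonicity
replaces an integral remainder. -/
theorem le_add_inner_add_of_lipschitz (hg : ∀ x, HasGradientAt F (g x) x)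
    (hL : ∀ x y, ‖g x - g y‖ ≤ L * ‖x - y‖) (x y : E) :
    F y ≤ F x + inner ℝ (g x) (y - x) + L / 2 * ‖y - x‖ ^ 2 := by
  set v := y - x with hv
  have hd : ∀ t : ℝ, HasDerivAt
      (fun t : ℝ => F (x + t • v) - t * inner ℝ (g x) v - L / 2 * ‖v‖ ^ 2 * t ^ 2)
      (inner ℝ (g (x + t • v)) v - inner ℝ (g x) v - L / 2 * ‖v‖ ^ 2 * (2 * t)) t := fun t => by
    have h1 := ((hasDerivAt_line hg x v t).sub ((hasDerivAt_id t).mul_const (inner ℝ (g x) v))).sub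
      ((hasDerivAt_pow 2 t).const_mul (L / 2 * ‖v‖ ^ 2))
    simpa using! h1
  have hanti : AntitoneOn
      (fun t : ℝ => F (x + t • v) - t * inner ℝ (g x) v - L / 2 * ‖v‖ ^ 2 * t ^ 2)
      (Set.Icc 0 1) := by
    refine antitoneOn_of_deriv_nonpos (convex_Icc 0 1)
      (fun t _ => (hd t).continuousAt.continuousWithinAt)
      (fun t _ => (hd t).differentiableAt.differentiableWithinAt) fun t ht => ?_
    rw [interior_Icc] at ht
    rw [(hd t).deriv, ← inner_sub_left]
    have h1 := real_inner_le_norm (g (x + t • v) - g x) v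
    have h2 := hL (x + t • v) x
    rw [add_sub_cancel_left, norm_smul, Real.norm_of_nonneg ht.1.le] at h2
    nlinarith [mul_le_mul_of_nonneg_right h2 (norm_nonneg v)]
  have h := hanti (Set.left_mem_Icc.2 zero_le_one) (Set.right_mem_Icc.2 zero_le_one) zero_le_one
  simp only [one_smul, zero_smul, add_zero, hv, add_sub_cancel] at h
  rw [hv]
  linarith

theorem strongConvexOn_mul_norm_sq_le_inner (hF : StrongConvexOn Set.univ μ F)
    (hg : ∀ x, HasGradientAt F (g x) x) (x y : E) :
    μ * ‖y - x‖ ^ 2 ≤ inner ℝ (y - x) (g y - g x) := by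
  have h1 := strongConvexOn_le_of_hasGradientAt hF hg x y
  have h2 := strongConvexOn_le_of_hasGradientAt hF hg y x
  rw [← neg_sub y x, inner_neg_right, norm_neg] at h2
  rw [inner_sub_right, real_inner_comm, real_inner_comm (g x)]
  linarith

/-- Baillon–Haddad cocoercivity at a zero `z`: convexity and the descent lemma at the two points `y
- g y / L` and `z + g y / L` give four inequalities in whose sum all function values cancel. -/
theorem norm_sq_le_of_gradient_eq_zero (hF : ConvexOn ℝ Set.univ F)
    (hg : ∀ x, HasGradientAt F (g x) x) (hL₀ : 0 < L)
    (hL : ∀ x y, ‖g x - g y‖ ≤ L * ‖x - y‖) {z : E} (hz : g z = 0) (y : E) :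
    ‖g y‖ ^ 2 ≤ L * inner ℝ (y - z) (g y) := by
  have hF' : StrongConvexOn Set.univ 0 F := strongConvexOn_zero.2 hF
  have e : ∀ u : E, ‖L⁻¹ • u‖ ^ 2 = L⁻¹ ^ 2 * ‖u‖ ^ 2 := fun u => by
    rw [norm_smul, mul_pow, Real.norm_of_nonneg (inv_nonneg.2 hL₀.le)]
  have h1 := strongConvexOn_le_of_hasGradientAt hF' hg z (y - L⁻¹ • g y)
  have h2 := le_add_inner_add_of_lipschitz hg hL y (y - L⁻¹ • g y)
  have h3 := strongConvexOn_le_of_hasGradientAt hF' hg y (z + L⁻¹ • g y)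
  have h4 := le_add_inner_add_of_lipschitz hg hL z (z + L⁻¹ • g y)
  rw [hz, inner_zero_left] at h1 h4
  rw [show y - L⁻¹ • g y - y = -(L⁻¹ • g y) by abel, inner_neg_right, norm_neg, e,
    real_inner_smul_right, real_inner_self_eq_norm_sq] at h2
  rw [show z + L⁻¹ • g y - y = L⁻¹ • g y - (y - z) by abel, inner_sub_right,
    real_inner_smul_right, real_inner_self_eq_norm_sq, real_inner_comm] at h3
  rw [add_sub_cancel_left, e] at h4
  have h5 : L * L⁻¹ = 1 := mul_inv_cancel₀ hL₀.ne'
  have h6 : L⁻¹ * ‖g y‖ ^ 2 ≤ inner ℝ (y - z) (g y) := by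
    have h7 : L / 2 * (L⁻¹ ^ 2 * ‖g y‖ ^ 2) = L⁻¹ / 2 * ‖g y‖ ^ 2 := by
      field_simp
    rw [h7] at h2 h4
    linarith
  have h8 := mul_le_mul_of_nonneg_left h6 hL₀.le
  rwa [← mul_assoc, h5, one_mul] at h8

omit [CompleteSpace E] in
/-- A cocoercive, strongly monotone field passes these properties on to its derivative at a zero. -/
theorem cocoercive_fderiv {z : E} {A : E →L[ℝ] E} (hA : HasFDerivAt g A z) (hz : g z = 0)
    (hco : ∀ y, ‖g y‖ ^ 2 ≤ L * inner ℝ (y - z) (g y))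
    (hmono : ∀ y, μ * ‖y - z‖ ^ 2 ≤ inner ℝ (y - z) (g y)) (v : E) :
    ‖A v‖ ^ 2 ≤ L * inner ℝ v (A v) ∧ μ * ‖v‖ ^ 2 ≤ inner ℝ v (A v) := by
  have h1 : Tendsto (fun t : ℝ => t⁻¹ • g (z + t • v)) (𝓝[>] 0) (𝓝 (A v)) := by
    have h2 : HasDerivAt (fun t : ℝ => z + t • v) v 0 := by
      simpa using ((hasDerivAt_id (0 : ℝ)).smul_const v).const_add z
    have h3 := (HasFDerivAt.comp_hasDerivAt (0 : ℝ) (by simpa using hA) h2).tendsto_slope_zero_right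
    simpa [hz] using h3
  have h2 : Tendsto (fun t : ℝ => inner ℝ v (t⁻¹ • g (z + t • v))) (𝓝[>] 0)
      (𝓝 (inner ℝ v (A v))) := tendsto_const_nhds.inner h1
  -- Both inequalities are quadratic in the increment, so they survive division by `t ^ 2` and the
  -- limit `t → 0`.
  have e : ∀ t : ℝ, 0 < t → inner ℝ (z + t • v - z) (g (z + t • v)) =
      t ^ 2 * inner ℝ v (t⁻¹ • g (z + t • v)) := fun t ht => by
    rw [add_sub_cancel_left, real_inner_smul_left, real_inner_smul_right]
    field_simp
  constructor
  · refine le_of_tendsto_of_tendsto (h1.norm.pow 2) (h2.const_mul L) ?_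
    filter_upwards [self_mem_nhdsWithin] with t ht
    have ht : 0 < t := ht
    have h3 := hco (z + t • v)
    rw [e t ht] at h3
    rw [norm_smul, mul_pow, Real.norm_of_nonneg (inv_nonneg.2 ht.le), inv_pow,
      inv_mul_le_iff₀ (by positivity)]
    linarith
  · refine le_of_tendsto_of_tendsto tendsto_const_nhds h2 ?_
    filter_upwards [self_mem_nhdsWithin] with t ht
    have ht : 0 < t := ht
    have h3 := hmono (z + t • v)
    rw [e t ht, add_sub_cancel_left, norm_smul, mul_pow, Real.norm_of_nonneg ht.le] at h3
    have h4 : 0 < t ^ 2 := by positivity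
    nlinarith

end ConvexAnalysis

theorem exists_isMinOn_of_isBounded {E : Type*} [NormedAddCommGroup E] [ProperSpace E] {F : E → ℝ} (hF : Continuous F)
    (hb : ∀ c, Bornology.IsBounded {x | F x ≤ c}) : ∃ x, IsMinOn F Set.univ x := by
  have hc : IsCompact {x | F x ≤ F 0} :=
    Metric.isCompact_of_isClosed_isBounded (isClosed_le hF continuous_const) (hb _)
  obtain ⟨x, hx, hmin⟩ := hc.exists_isMinOn ⟨0, le_refl (F 0)⟩ hF.continuousOn
  refine ⟨x, fun y _ => ?_⟩
  by_cases hy : F y ≤ F 0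
  · exact hmin hy
  · exact le_trans hx (not_le.1 hy).le

/-! ### Differentiability of a branch of zeros -/

section ImplicitDerivative

variable {E F : Type*} [NormedAddCommGroup E] [NormedSpace ℝ E] [FiniteDimensional ℝ E]
  [NormedAddCommGroup F] [NormedSpace ℝ F]

/-- A Lipschitz branch of zeros of `G` is differentiable where the partial derivative of `G` is
injective. -/
theorem differentiableAt_of_zero_branch {G : E × F → E} {z : F → E} {θ : F}
    {A : E →L[ℝ] E} {B : F →L[ℝ] E} {C : ℝ} (hG : HasFDerivAt G (A.coprod B) (z θ, θ))
    (hA : Function.Injective A) (hz : ∀ᶠ θ' in 𝓝 θ, G (z θ', θ') = 0)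
    (hLip : ∀ᶠ θ' in 𝓝 θ, ‖z θ' - z θ‖ ≤ C * ‖θ' - θ‖) : DifferentiableAt ℝ z θ := by
  have hbO : (fun θ' => z θ' - z θ) =O[𝓝 θ] fun θ' => θ' - θ := Asymptotics.IsBigO.of_bound C hLip
  have hcont : Tendsto z (𝓝 θ) (𝓝 (z θ)) := by
    rw [tendsto_iff_norm_sub_tendsto_zero]
    refine squeeze_zero' (Eventually.of_forall fun _ => norm_nonneg _) hLip ?_
    have : Continuous fun θ' : F => C * ‖θ' - θ‖ := by fun_prop
    simpa using this.tendsto θ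
  have hpair : Tendsto (fun θ' => (z θ', θ')) (𝓝 θ) (𝓝 (z θ, θ)) :=
    hcont.prodMk_nhds tendsto_id
  have h1 := hG.isLittleO.comp_tendsto hpair
  -- Since `G` vanishes along the branch, only its linear part remains, and the Lipschitz bound
  -- turns the error into `o(θ' - θ)`. Inverting `A` then reads off the derivative.
  have h2 : (fun θ' => A (z θ' - z θ) + B (θ' - θ)) =o[𝓝 θ] fun θ' => θ' - θ := by
    have h3 : ((fun p : E × F => p - (z θ, θ)) ∘ fun θ' => (z θ', θ')) =O[𝓝 θ]
        fun θ' => θ' - θ := hbO.prod_left (Asymptotics.isBigO_refl _ _)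
    refine (h1.trans_isBigO h3).neg_left.congr' ?_ EventuallyEq.rfl
    filter_upwards [hz] with θ' hθ'
    simp [hθ', hz.self_of_nhds]
  let e : E ≃L[ℝ] E := (LinearEquiv.ofInjectiveEndo (A : E →ₗ[ℝ] E) hA).toContinuousLinearEquiv
  have he : ∀ v, e.symm (A v) = v := fun v => e.symm_apply_apply v
  refine (HasFDerivAt.of_isLittleO (f' := -((e.symm : E →L[ℝ] E).comp B)) ?_).differentiableAt
  refine (((e.symm : E →L[ℝ] E).isBigO_comp _ _).trans_isLittleO h2).congr_left fun θ' => ?_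
  simp [map_add, he]
  abel

end ImplicitDerivative

/-! ### Regularity of the objective and of its minimizer -/

section Objective

variable {n m : ℕ} {f : Euc n → Euc m → ℝ} {Θ : Set (Euc m)} {L : ℝ}

theorem SmoothObjective.differentiableAt_left (hf : SmoothObjective f Θ L) (hΘ : IsOpen Θ)
    {θ : Euc m} (hθ : θ ∈ Θ) (x : Euc n) :
    DifferentiableAt ℝ (fun p : Euc n × Euc m => f p.1 p.2) (x, θ) :=
  (hf.contDiffOn.contDiffAt ((isOpen_univ.prod hΘ).mem_nhds ⟨trivial, hθ⟩)).differentiableAt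
    (by norm_num)

theorem SmoothObjective.hasFDerivAt_left (hf : SmoothObjective f Θ L) (hΘ : IsOpen Θ)
    {θ : Euc m} (hθ : θ ∈ Θ) (x : Euc n) :
    HasFDerivAt (fun y => f y θ) ((fderiv ℝ (fun p : Euc n × Euc m => f p.1 p.2) (x, θ)).comp
      (ContinuousLinearMap.inl ℝ (Euc n) (Euc m))) x :=
  HasFDerivAt.comp (f := fun y => (y, θ)) x (hf.differentiableAt_left hΘ hθ x).hasFDerivAt
    (hasFDerivAt_prodMk_left x θ)

theorem SmoothObjective.hasGradientAt (hf : SmoothObjective f Θ L) (hΘ : IsOpen Θ)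
    {θ : Euc m} (hθ : θ ∈ Θ) (x : Euc n) :
    HasGradientAt (fun y => f y θ) (gradX f x θ) x :=
  (hf.hasFDerivAt_left hΘ hθ x).differentiableAt.hasGradientAt

theorem SmoothObjective.contDiffOn_gradX (hf : SmoothObjective f Θ L) (hΘ : IsOpen Θ) :
    ContDiffOn ℝ 1 (fun p : Euc n × Euc m => gradX f p.1 p.2) (Set.univ ×ˢ Θ) := by
  have h1 := hf.contDiffOn.fderiv_of_isOpen (m := 1) (isOpen_univ.prod hΘ) (by norm_num)
  have h2 := h1.clm_comp (contDiffOn_const (c := ContinuousLinearMap.inl ℝ (Euc n) (Euc m)))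
  have h3 := (InnerProductSpace.toDual ℝ (Euc n)).symm.toContinuousLinearEquiv.contDiff.comp_contDiffOn
    h2
  refine h3.congr fun p hp => ?_
  have h4 := (hf.hasFDerivAt_left hΘ hp.2 p.1).fderiv
  simp only [gradX, gradient, h4]
  rfl

theorem SmoothObjective.hasFDerivAt_gradX (hf : SmoothObjective f Θ L) (hΘ : IsOpen Θ)
    {θ : Euc m} (hθ : θ ∈ Θ) (x : Euc n) :
    HasFDerivAt (fun p : Euc n × Euc m => gradX f p.1 p.2)
      (fderiv ℝ (fun p : Euc n × Euc m => gradX f p.1 p.2) (x, θ)) (x, θ) :=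
  (((hf.contDiffOn_gradX hΘ).contDiffAt
    ((isOpen_univ.prod hΘ).mem_nhds ⟨trivial, hθ⟩)).differentiableAt (by norm_num)).hasFDerivAt

theorem SmoothObjective.continuousAt_fderiv_gradX (hf : SmoothObjective f Θ L) (hΘ : IsOpen Θ)
    {θ : Euc m} (hθ : θ ∈ Θ) (x : Euc n) :
    ContinuousAt (fderiv ℝ (fun p : Euc n × Euc m => gradX f p.1 p.2)) (x, θ) :=
  ((hf.contDiffOn_gradX hΘ).continuousOn_fderiv_of_isOpen (isOpen_univ.prod hΘ)
    le_rfl).continuousAt ((isOpen_univ.prod hΘ).mem_nhds ⟨trivial, hθ⟩)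

theorem SmoothObjective.isMinOn_xStar (hf : SmoothObjective f Θ L) (hΘ : IsOpen Θ)
    {θ : Euc m} (hθ : θ ∈ Θ) : IsMinOn (fun y => f y θ) Set.univ (xStar f θ) := by
  refine Classical.epsilon_spec (p := fun x => IsMinOn (fun y => f y θ) Set.univ x)
    (exists_isMinOn_of_isBounded ?_ (hf.levelBounded θ hθ))
  exact continuous_iff_continuousAt.2 fun x => (hf.hasFDerivAt_left hΘ hθ x).continuousAt

theorem SmoothObjective.gradX_xStar (hf : SmoothObjective f Θ L) (hΘ : IsOpen Θ)
    {θ : Euc m} (hθ : θ ∈ Θ) : gradX f (xStar f θ) θ = 0 := by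
  have h1 := ((hf.isMinOn_xStar hΘ hθ).isLocalMin univ_mem).hasFDerivAt_eq_zero
    (hf.hasGradientAt hΘ hθ _).hasFDerivAt
  simpa using h1

theorem SmoothObjective.isMinOn_iff_eq_xStar (hf : SmoothObjective f Θ L) (hΘ : IsOpen Θ)
    {θ : Euc m} (hθ : θ ∈ Θ) {μ : ℝ} (hμ : 0 < μ)
    (hconv : StrongConvexOn Set.univ μ (fun x => f x θ)) (x : Euc n) :
    IsMinOn (fun y => f y θ) Set.univ x ↔ x = xStar f θ :=
  ⟨fun h => (hconv.strictConvexOn hμ).eq_of_isMinOn h (hf.isMinOn_xStar hΘ hθ) trivial trivial,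
    fun h => h ▸ hf.isMinOn_xStar hΘ hθ⟩

theorem SmoothObjective.norm_gradX_sq_le (hf : SmoothObjective f Θ L) (hΘ : IsOpen Θ) (hL : 0 < L)
    {θ : Euc m} (hθ : θ ∈ Θ) {μ : ℝ} (hμ : 0 < μ)
    (hconv : StrongConvexOn Set.univ μ (fun x => f x θ)) (y : Euc n) :
    ‖gradX f y θ‖ ^ 2 ≤ L * inner ℝ (y - xStar f θ) (gradX f y θ) :=
  norm_sq_le_of_gradient_eq_zero (strongConvexOn_zero.1 (hconv.mono hμ.le))
    (hf.hasGradientAt hΘ hθ) hL (hf.lipschitz_x θ hθ) (hf.gradX_xStar hΘ hθ) y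

theorem SmoothObjective.mul_norm_sub_xStar_sq_le (hf : SmoothObjective f Θ L) (hΘ : IsOpen Θ)
    {θ : Euc m} (hθ : θ ∈ Θ) {μ : ℝ} (hconv : StrongConvexOn Set.univ μ (fun x => f x θ))
    (y : Euc n) : μ * ‖y - xStar f θ‖ ^ 2 ≤ inner ℝ (y - xStar f θ) (gradX f y θ) := by
  simpa [hf.gradX_xStar hΘ hθ] using
    strongConvexOn_mul_norm_sq_le_inner hconv (hf.hasGradientAt hΘ hθ) (xStar f θ) y

/-- Strong monotonicity at `θ` is tested at the minimizer for `θ'`, where the gradient at `θ` is at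
most `L ‖θ' - θ‖`. Only the modulus at `θ` enters, so no uniformity in the parameter is needed. -/
theorem SmoothObjective.norm_xStar_sub_le (hf : SmoothObjective f Θ L) (hΘ : IsOpen Θ)
    {θ θ' : Euc m} (hθ : θ ∈ Θ) (hθ' : θ' ∈ Θ) {μ : ℝ} (hμ : 0 < μ)
    (hconv : StrongConvexOn Set.univ μ (fun x => f x θ)) :
    ‖xStar f θ' - xStar f θ‖ ≤ L / μ * ‖θ' - θ‖ := by
  have h1 := hf.mul_norm_sub_xStar_sq_le hΘ hθ hconv (xStar f θ')
  have h2 := hf.lipschitz_theta (xStar f θ') θ hθ θ' hθ'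
  rw [hf.gradX_xStar hΘ hθ', sub_zero, norm_sub_rev] at h2
  have h3 := real_inner_le_norm (xStar f θ' - xStar f θ) (gradX f (xStar f θ') θ)
  rw [div_mul_eq_mul_div, le_div_iff₀ hμ]
  rcases (norm_nonneg (xStar f θ' - xStar f θ)).eq_or_lt with h0 | h0
  · rw [← h0, zero_mul]
    exact (norm_nonneg _).trans h2
  · refine le_of_mul_le_mul_left ?_ h0
    nlinarith [mul_le_mul_of_nonneg_left h2 h0.le]

/-- The partial Hessian at the minimizer inherits cocoercivity and strong monotonicity. -/
theorem SmoothObjective.hessian_bounds (hf : SmoothObjective f Θ L) (hΘ : IsOpen Θ) (hL : 0 < L)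
    {θ : Euc m} (hθ : θ ∈ Θ) {μ : ℝ} (hμ : 0 < μ)
    (hconv : StrongConvexOn Set.univ μ (fun x => f x θ)) {A : Euc n →L[ℝ] Euc n}
    (hA : HasFDerivAt (fun x => gradX f x θ) A (xStar f θ)) (v : Euc n) :
    ‖A v‖ ^ 2 ≤ L * inner ℝ v (A v) ∧ μ * ‖v‖ ^ 2 ≤ inner ℝ v (A v) :=
  cocoercive_fderiv hA (hf.gradX_xStar hΘ hθ) (hf.norm_gradX_sq_le hΘ hL hθ hμ hconv)
    (hf.mul_norm_sub_xStar_sq_le hΘ hθ hconv) v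

theorem SmoothObjective.hasFDerivAt_gradX_left (hf : SmoothObjective f Θ L) (hΘ : IsOpen Θ)
    {θ : Euc m} (hθ : θ ∈ Θ) (x : Euc n) :
    HasFDerivAt (fun y => gradX f y θ)
      ((fderiv ℝ (fun p : Euc n × Euc m => gradX f p.1 p.2) (x, θ)).comp
        (ContinuousLinearMap.inl ℝ (Euc n) (Euc m))) x :=
  HasFDerivAt.comp (f := fun y => (y, θ)) x (hf.hasFDerivAt_gradX hΘ hθ x)
    (hasFDerivAt_prodMk_left x θ)

theorem SmoothObjective.differentiableAt_xStar (hf : SmoothObjective f Θ L) (hΘ : IsOpen Θ)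
    (hL : 0 < L) {θ : Euc m} (hθ : θ ∈ Θ) {μ : ℝ} (hμ : 0 < μ)
    (hconv : StrongConvexOn Set.univ μ (fun x => f x θ)) :
    DifferentiableAt ℝ (xStar f) θ := by
  have h1 := hf.hasFDerivAt_gradX hΘ hθ (xStar f θ)
  have h2 := hf.hessian_bounds hΘ hL hθ hμ hconv (hf.hasFDerivAt_gradX_left hΘ hθ _)
  set D := fderiv ℝ (fun p : Euc n × Euc m => gradX f p.1 p.2) (xStar f θ, θ)
  have h3 : (D.comp (ContinuousLinearMap.inl ℝ (Euc n) (Euc m))).coprod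
      (D.comp (ContinuousLinearMap.inr ℝ (Euc n) (Euc m))) = D := D.coprod_comp_inl_inr
  rw [← h3] at h1
  refine differentiableAt_of_zero_branch h1 ?_ ?_ (C := L / μ) ?_
  · refine (injective_iff_map_eq_zero _).2 fun v hv => ?_
    have h4 := (h2 v).2
    rw [hv, inner_zero_right] at h4
    have h5 : ‖v‖ ^ 2 ≤ 0 := by nlinarith [sq_nonneg ‖v‖]
    simpa using h5
  · filter_upwards [hΘ.mem_nhds hθ] with θ' hθ' using hf.gradX_xStar hΘ hθ'
  · filter_upwards [hΘ.mem_nhds hθ] with θ' hθ' using hf.norm_xStar_sub_le hΘ hθ hθ' hμ hconv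

end Objective

/-! ### Limits of operators -/

section OperatorLimits

variable {E E' F : Type*} [NormedAddCommGroup E] [NormedSpace ℝ E] [NormedAddCommGroup E']
  [NormedSpace ℝ E'] [NormedAddCommGroup F] [NormedSpace ℝ F] {ι : Type*} {l : Filter ι}

theorem tendsto_clm_comp {f : ι → E' →L[ℝ] F} {g : ι → E →L[ℝ] E'} {f' : E' →L[ℝ] F}
    {g' : E →L[ℝ] E'} (hf : Tendsto f l (𝓝 f')) (hg : Tendsto g l (𝓝 g')) :
    Tendsto (fun i => (f i).comp (g i)) l (𝓝 (f'.comp g')) := by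
  have hc : Continuous fun p : (E' →L[ℝ] F) × (E →L[ℝ] E') => p.1.comp p.2 :=
    continuous_fst.clm_comp continuous_snd
  exact (hc.tendsto (f', g')).comp (hf.prodMk_nhds hg)

theorem tendsto_add_smul {c : ι → ℝ} {c' : ℝ} (P Q : E) (hc : Tendsto c l (𝓝 c')) :
    Tendsto (fun i => P + c i • Q) l (𝓝 (P + c' • Q)) :=
  (hc.smul_const Q).const_add P

end OperatorLimits

theorem continuousSMul_euc2 (n : ℕ) : ContinuousSMul ℝ (Euc2 n) :=
  IsBoundedSMul.continuousSMul

attribute [local instance] continuousSMul_euc2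

/-! ### Linearization of one step and convergence of the iterates -/

section Step

variable {n m : ℕ} {f : Euc n → Euc m → ℝ} {Θ : Set (Euc m)} {L : ℝ}

/-- The coordinates `(x, z) ↦ x` of the doubled space. -/
noncomputable abbrev fstEuc (n : ℕ) : Euc2 n →L[ℝ] Euc n := WithLp.fstL 2 ℝ (Euc n) (Euc n)

/-- The coordinates `(x, z) ↦ z` of the doubled space. -/
noncomputable abbrev sndEuc (n : ℕ) : Euc2 n →L[ℝ] Euc n := WithLp.sndL 2 ℝ (Euc n) (Euc n)

/-- The embedding `x ↦ (x, 0)` into the doubled space. -/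
noncomputable def inlEuc (n : ℕ) : Euc n →L[ℝ] Euc2 n :=
  ((WithLp.prodContinuousLinearEquiv 2 ℝ (Euc n) (Euc n)).symm : _ →L[ℝ] Euc2 n).comp
    (ContinuousLinearMap.inl ℝ (Euc n) (Euc n))

/-- The embedding `x ↦ (0, x)` into the doubled space. -/
noncomputable def inrEuc (n : ℕ) : Euc n →L[ℝ] Euc2 n :=
  ((WithLp.prodContinuousLinearEquiv 2 ℝ (Euc n) (Euc n)).symm : _ →L[ℝ] Euc2 n).comp
    (ContinuousLinearMap.inr ℝ (Euc n) (Euc n))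

/-- Inertial extrapolation `(x, z) ↦ x + b (x - z)`. -/
noncomputable def extrap (n : ℕ) (b : ℝ) : Euc2 n →L[ℝ] Euc n :=
  fstEuc n + b • (fstEuc n - sndEuc n)

/-- The derivative of a step of the method in its state, if the partial Hessian is `A`. -/
noncomputable def stepCLM {n : ℕ} (a b γ : ℝ) (A : Euc n →L[ℝ] Euc n) : Euc2 n →L[ℝ] Euc2 n :=
  (inlEuc n).comp (extrap n a - γ • A.comp (extrap n b)) + (inrEuc n).comp (fstEuc n)

/-- The derivative of a step of the method in the parameter, if the mixed derivative of the
objective is `B`. -/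
noncomputable def stepForcing {n m : ℕ} (γ : ℝ) (B : Euc m →L[ℝ] Euc n) : Euc m →L[ℝ] Euc2 n :=
  (inlEuc n).comp (-(γ • B))

theorem inlEuc_add_inrEuc (x z : Euc n) : inlEuc n x + inrEuc n z = WithLp.toLp 2 (x, z) := by
  simp [inlEuc, inrEuc, ← WithLp.toLp_add]

theorem stepCLM_fst (a b γ : ℝ) (A : Euc n →L[ℝ] Euc n) (z : Euc2 n) :
    (stepCLM a b γ A z).fst = z.fst + a • (z.fst - z.snd) - γ • A (z.fst + b • (z.fst - z.snd)) := by
  simp [stepCLM, extrap, inlEuc, inrEuc]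

theorem stepCLM_snd (a b γ : ℝ) (A : Euc n →L[ℝ] Euc n) (z : Euc2 n) :
    (stepCLM a b γ A z).snd = z.fst := by
  simp [stepCLM, extrap, inlEuc, inrEuc]

theorem step_eq (a b γ : ℝ) (X : Euc2 n) (θ : Euc m) :
    step f a b γ X θ =
      inlEuc n (extrap n a X - γ • gradX f (extrap n b X) θ) + inrEuc n (fstEuc n X) := by
  rw [inlEuc_add_inrEuc]
  rfl

theorem tendsto_stepCLM {a b γ : ℕ → ℝ} {A : ℕ → Euc n →L[ℝ] Euc n} {a' b' γ' : ℝ}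
    {A' : Euc n →L[ℝ] Euc n} (ha : Tendsto a atTop (𝓝 a')) (hb : Tendsto b atTop (𝓝 b'))
    (hγ : Tendsto γ atTop (𝓝 γ')) (hA : Tendsto A atTop (𝓝 A')) :
    Tendsto (fun k => stepCLM (a k) (b k) (γ k) (A k)) atTop (𝓝 (stepCLM a' b' γ' A')) := by
  have h1 : ∀ {c : ℕ → ℝ} {c' : ℝ}, Tendsto c atTop (𝓝 c') →
      Tendsto (fun k => extrap n (c k)) atTop (𝓝 (extrap n c')) := fun hc =>
    tendsto_add_smul (fstEuc n) (fstEuc n - sndEuc n) hc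
  have h2 := (h1 ha).sub (hγ.smul (tendsto_clm_comp hA (h1 hb)))
  exact (tendsto_clm_comp tendsto_const_nhds h2).add_const ((inrEuc n).comp (fstEuc n))

theorem tendsto_stepForcing {γ : ℕ → ℝ} {B : ℕ → Euc m →L[ℝ] Euc n} {γ' : ℝ}
    {B' : Euc m →L[ℝ] Euc n} (hγ : Tendsto γ atTop (𝓝 γ')) (hB : Tendsto B atTop (𝓝 B')) :
    Tendsto (fun k => stepForcing (γ k) (B k)) atTop (𝓝 (stepForcing γ' B')) := by
  exact tendsto_clm_comp tendsto_const_nhds (hγ.smul hB).neg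

theorem hasFDerivAt_step {a b γ : ℝ} {X : Euc m → Euc2 n} {D : Euc m →L[ℝ] Euc2 n} {θ : Euc m}
    {A : Euc n →L[ℝ] Euc n} {B : Euc m →L[ℝ] Euc n} (hX : HasFDerivAt X D θ)
    (hG : HasFDerivAt (fun p : Euc n × Euc m => gradX f p.1 p.2) (A.coprod B)
      (extrap n b (X θ), θ)) :
    HasFDerivAt (fun θ' => step f a b γ (X θ') θ')
      ((stepCLM a b γ A).comp D + stepForcing γ B) θ := by
  simp only [step_eq]
  have h1 : HasFDerivAt (fun θ' => gradX f (extrap n b (X θ')) θ')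
      ((A.coprod B).comp (((extrap n b).comp D).prod (ContinuousLinearMap.id ℝ (Euc m)))) θ :=
    HasFDerivAt.comp (f := fun θ' => (extrap n b (X θ'), θ')) θ hG
      (((extrap n b).hasFDerivAt.comp θ hX).prodMk (hasFDerivAt_id θ))
  have h2 := ((inlEuc n).hasFDerivAt.comp θ
    (((extrap n a).hasFDerivAt.comp θ hX).sub (h1.const_smul γ))).add
    ((inrEuc n).hasFDerivAt.comp θ ((fstEuc n).hasFDerivAt.comp θ hX))
  refine h2.congr_fderiv (ContinuousLinearMap.ext fun v => ?_)
  simp only [stepCLM, stepForcing, add_apply, sub_apply,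
    smul_apply, neg_apply, ContinuousLinearMap.comp_apply,
    ContinuousLinearMap.prod_apply, ContinuousLinearMap.coprod_apply,
    ContinuousLinearMap.id_apply, map_sub, map_add, map_smul, map_neg, smul_add]
  abel

theorem hasFDerivAt_gradX_coprod (hf : SmoothObjective f Θ L) (hΘ : IsOpen Θ)
    {θ : Euc m} (hθ : θ ∈ Θ) (x : Euc n) :
    HasFDerivAt (fun p : Euc n × Euc m => gradX f p.1 p.2)
      (((fderiv ℝ (fun p : Euc n × Euc m => gradX f p.1 p.2) (x, θ)).comp
        (ContinuousLinearMap.inl ℝ (Euc n) (Euc m))).coprod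
      ((fderiv ℝ (fun p : Euc n × Euc m => gradX f p.1 p.2) (x, θ)).comp
        (ContinuousLinearMap.inr ℝ (Euc n) (Euc m)))) (x, θ) := by
  rw [ContinuousLinearMap.coprod_comp_inl_inr]
  exact hf.hasFDerivAt_gradX hΘ hθ x

/-- In the limit, the global convergence condition becomes a single strict inequality. -/
theorem GlobalCondition.limit_pos {a b γ : ℕ → ℝ} {a' b' γ' : ℝ} (hL : 0 < L)
    (hpar : AdmissibleParams a b γ L) (hglob : GlobalCondition a b γ L)
    (hlim : ParamLimits a b γ L a' b' γ') :
    0 < 1 - γ' * L / 2 - a' - γ' * L / 2 * b' ^ 2 - 2 * |a' - γ' * L / 2 * b'| := by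
  obtain ⟨τ, hτ, h⟩ := hglob
  have hc := ((hlim.γ_tendsto.mul_const L).div_const 2)
  have ht := (((hc.const_sub 1).sub hlim.a_tendsto).sub (hc.mul (hlim.b_tendsto.pow 2))).sub
    ((hlim.a_tendsto.sub (hc.mul hlim.b_tendsto)).abs.const_mul 2)
  refine hτ.trans_le (ge_of_tendsto' ht fun k => ?_)
  have hγ := hpar.γ_mem k
  have hc1 : γ k * L / 2 ≤ 1 := by
    have := hγ.2
    rw [lt_div_iff₀ hL] at this
    linarith
  -- With `c = γ L / 2`, the two cases are the two signs of `a - c b`, and opening the absolute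
  -- value gives the respective bound. The alternative `b ≤ a` belongs to the second because `c ≤
  -- 1`.
  rcases h k with ⟨h1, h2⟩ | ⟨h1, h2⟩
  · rw [abs_of_neg (by linarith)]
    nlinarith
  · have h3 : γ k * L / 2 * b k ≤ a k := by
      rcases h1 with h1 | h1
      · exact (mul_le_of_le_one_left (hpar.b_mem k).1 hc1).trans h1
      · exact h1.1
    rw [abs_of_nonneg (by linarith)]
    nlinarith

theorem tendsto_zero_of_fst_snd {z : ℕ → Euc2 n} (h1 : Tendsto (fun k => (z k).fst) atTop (𝓝 0))
    (h2 : Tendsto (fun k => (z k).snd) atTop (𝓝 0)) : Tendsto z atTop (𝓝 0) := by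
  have h := (((inlEuc n).continuous.tendsto 0).comp h1).add
    (((inrEuc n).continuous.tendsto 0).comp h2)
  simp only [map_zero, add_zero] at h
  refine h.congr fun k => ?_
  exact inlEuc_add_inrEuc _ _

/-- The limiting linearized method has a contractive power. -/
theorem exists_norm_stepCLM_pow_lt_one {a b γ μ : ℝ} (hL : 0 < L) (hμ : 0 < μ) (ha : 0 ≤ a)
    (hb : b ∈ Set.Icc (0 : ℝ) 1) (hγ : 0 < γ)
    (hcond : 0 < 1 - γ * L / 2 - a - γ * L / 2 * b ^ 2 - 2 * |a - γ * L / 2 * b|)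
    {A : Euc n →L[ℝ] Euc n}
    (hA : ∀ v, ‖A v‖ ^ 2 ≤ L * inner ℝ v (A v) ∧ μ * ‖v‖ ^ 2 ≤ inner ℝ v (A v)) :
    ∃ p, 0 < p ∧ ‖stepCLM a b γ A ^ p‖ < 1 := by
  refine exists_norm_pow_lt_one fun z => ?_
  have hs : ∀ k, (stepCLM a b γ A ^ (k + 1)) z = stepCLM a b γ A ((stepCLM a b γ A ^ k) z) :=
    fun k => by rw [pow_succ', mul_apply_eq_comp]
  -- An orbit of `stepCLM` is itself an inertial method, with constant parameters and driving field
  -- `A`.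
  have h1 : Tendsto (fun k => ((stepCLM a b γ A ^ k) z).fst) atTop (𝓝 0) :=
    inertial_tendsto_zero (w := fun k => ((stepCLM a b γ A ^ k) z).snd)
      (g := fun k => A (((stepCLM a b γ A ^ k) z).fst
        + b • (((stepCLM a b γ A ^ k) z).fst - ((stepCLM a b γ A ^ k) z).snd)))
      (a := fun _ => a) (b := fun _ => b) (γ := fun _ => γ)
      hL hμ (fun _ => hb) (fun _ => hγ.le) ha hγ tendsto_const_nhds tendsto_const_nhds
      tendsto_const_nhds hcond (fun k => by rw [hs, stepCLM_snd])
      (fun k => by rw [hs, stepCLM_fst]) (fun k => (hA _).1) (fun k => (hA _).2)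
  refine tendsto_zero_of_fst_snd h1 ((tendsto_add_atTop_iff_nat 1).1 (h1.congr fun k => ?_))
  rw [hs, stepCLM_snd]

/-- Global convergence of the inertial method. -/
theorem tendsto_iter_fst (hΘ : IsOpen Θ) (hL : 0 < L) (hf : SmoothObjective f Θ L)
    {a b γ : ℕ → ℝ} (hpar : AdmissibleParams a b γ L) (hglob : GlobalCondition a b γ L)
    {a' b' γ' : ℝ} (hlim : ParamLimits a b γ L a' b' γ') (X₀ : Euc m → Euc2 n)
    {θ : Euc m} (hθ : θ ∈ Θ) {μ : ℝ} (hμ : 0 < μ)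
    (hconv : StrongConvexOn Set.univ μ (fun x => f x θ)) :
    Tendsto (fun k => (iter f a b γ X₀ k θ).fst) atTop (𝓝 (xStar f θ)) := by
  set X := fun k => iter f a b γ X₀ k θ with hX
  have hy : ∀ k, (X k).fst - xStar f θ + b k • ((X k).fst - xStar f θ - ((X k).snd - xStar f θ)) =
      (X k).fst + b k • ((X k).fst - (X k).snd) - xStar f θ := fun k => by module
  have h1 : Tendsto (fun k => (X k).fst - xStar f θ) atTop (𝓝 0) :=
    inertial_tendsto_zero (w := fun k => (X k).snd - xStar f θ)
      (g := fun k => gradX f ((X k).fst + b k • ((X k).fst - (X k).snd)) θ)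
      hL hμ hpar.b_mem (fun k => (hpar.γ_mem k).1.le) hlim.a_mem.1 hlim.γ_mem.1
      hlim.a_tendsto hlim.b_tendsto hlim.γ_tendsto (hglob.limit_pos hL hpar hlim)
      (fun k => rfl)
      (fun k => by
        have : (X (k + 1)).fst = (X k).fst + a k • ((X k).fst - (X k).snd)
          - γ k • gradX f ((X k).fst + b k • ((X k).fst - (X k).snd)) θ := rfl
        rw [this]
        module)
      (fun k => by rw [hy]; exact hf.norm_gradX_sq_le hΘ hL hθ hμ hconv _)
      (fun k => by rw [hy]; exact hf.mul_norm_sub_xStar_sq_le hΘ hθ hconv _)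
  simpa using h1.add_const (xStar f θ)

end Step

/-! ### Convergence of the derivatives -/

section Derivatives

variable {n m : ℕ} {f : Euc n → Euc m → ℝ} {Θ : Set (Euc m)} {L : ℝ}

theorem differentiableAt_iter (hΘ : IsOpen Θ) (hf : SmoothObjective f Θ L) (a b γ : ℕ → ℝ)
    {X₀ : Euc m → Euc2 n} (hX₀ : ContDiffOn ℝ 1 X₀ Θ) {θ : Euc m} (hθ : θ ∈ Θ) (k : ℕ) :
    DifferentiableAt ℝ (iter f a b γ X₀ k) θ := by
  induction k with
  | zero => exact (hX₀.contDiffAt (hΘ.mem_nhds hθ)).differentiableAt (by norm_num)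
  | succ k ih =>
    exact (hasFDerivAt_step ih.hasFDerivAt (hasFDerivAt_gradX_coprod hf hΘ hθ _)).differentiableAt

theorem differentiableAt_XStar (hΘ : IsOpen Θ) (hL : 0 < L) (hf : SmoothObjective f Θ L)
    {θ : Euc m} (hθ : θ ∈ Θ) {μ : ℝ} (hμ : 0 < μ)
    (hconv : StrongConvexOn Set.univ μ (fun x => f x θ)) : DifferentiableAt ℝ (XStar f) θ := by
  have h1 := hf.differentiableAt_xStar hΘ hL hθ hμ hconv
  have h2 : XStar f = fun θ' => inlEuc n (xStar f θ') + inrEuc n (xStar f θ') :=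
    funext fun θ' => (inlEuc_add_inrEuc _ _).symm
  rw [h2]
  fun_prop

theorem step_XStar (hf : SmoothObjective f Θ L) (hΘ : IsOpen Θ) {θ : Euc m} (hθ : θ ∈ Θ)
    (a b γ : ℝ) : step f a b γ (XStar f θ) θ = XStar f θ := by
  have := hf.gradX_xStar hΘ hθ
  simp [step, XStar, this]

/-- The derivative of the solution map is a fixed point of the linearized method. -/
theorem fderiv_XStar_eq (hΘ : IsOpen Θ) (hL : 0 < L) (hf : SmoothObjective f Θ L)
    {θ : Euc m} (hθ : θ ∈ Θ) {μ : ℝ} (hμ : 0 < μ)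
    (hconv : StrongConvexOn Set.univ μ (fun x => f x θ)) (a b γ : ℝ) {A : Euc n →L[ℝ] Euc n}
    {B : Euc m →L[ℝ] Euc n}
    (hG : HasFDerivAt (fun p : Euc n × Euc m => gradX f p.1 p.2) (A.coprod B) (xStar f θ, θ)) :
    fderiv ℝ (XStar f) θ = (stepCLM a b γ A).comp (fderiv ℝ (XStar f) θ) + stepForcing γ B := by
  have he : extrap n b (XStar f θ) = xStar f θ := by simp [extrap, XStar]
  -- The minimizer is fixed by every step, for all parameters near `θ`, so the identity can be
  -- differentiated.
  have hev : XStar f =ᶠ[𝓝 θ] fun θ' => step f a b γ (XStar f θ') θ' := by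
    filter_upwards [hΘ.mem_nhds hθ] with θ' hθ'
    exact (step_XStar hf hΘ hθ' a b γ).symm
  rw [← he] at hG
  exact hev.fderiv_eq.trans (hasFDerivAt_step
    (differentiableAt_XStar hΘ hL hf hθ hμ hconv).hasFDerivAt hG).fderiv

/-- The derivatives of the iterates converge to the derivative of the solution map. -/
theorem tendsto_fderiv_iter (hΘ : IsOpen Θ) (hL : 0 < L) (hf : SmoothObjective f Θ L)
    {a b γ : ℕ → ℝ} (hpar : AdmissibleParams a b γ L) (hglob : GlobalCondition a b γ L)
    {a' b' γ' : ℝ} (hlim : ParamLimits a b γ L a' b' γ') {X₀ : Euc m → Euc2 n}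
    (hX₀ : ContDiffOn ℝ 1 X₀ Θ) {θ : Euc m} (hθ : θ ∈ Θ) {μ : ℝ} (hμ : 0 < μ)
    (hconv : StrongConvexOn Set.univ μ (fun x => f x θ)) :
    Tendsto (fun k => fderiv ℝ (iter f a b γ X₀ k) θ - fderiv ℝ (XStar f) θ) atTop (𝓝 0) := by
  let dG : Euc n → (Euc n × Euc m →L[ℝ] Euc n) := fun x =>
    fderiv ℝ (fun p : Euc n × Euc m => gradX f p.1 p.2) (x, θ)
  let A : Euc n → (Euc n →L[ℝ] Euc n) := fun x =>
    (dG x).comp (ContinuousLinearMap.inl ℝ (Euc n) (Euc m))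
  let B : Euc n → (Euc m →L[ℝ] Euc n) := fun x =>
    (dG x).comp (ContinuousLinearMap.inr ℝ (Euc n) (Euc m))
  have hG : ∀ x, HasFDerivAt (fun p : Euc n × Euc m => gradX f p.1 p.2)
      ((A x).coprod (B x)) (x, θ) := hasFDerivAt_gradX_coprod hf hΘ hθ
  set S := fderiv ℝ (XStar f) θ with hS
  set T' := stepCLM a' b' γ' (A (xStar f θ)) with hT'
  set N' := stepForcing γ' (B (xStar f θ)) with hN'
  set y : ℕ → Euc n := fun k => extrap n (b k) (iter f a b γ X₀ k θ) with hy
  have hstar : S = T'.comp S + N' :=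
    fderiv_XStar_eq hΘ hL hf hθ hμ hconv a' b' γ' (hG (xStar f θ))
  have hx := tendsto_iter_fst hΘ hL hf hpar hglob hlim X₀ hθ hμ hconv
  have hz : Tendsto (fun k => (iter f a b γ X₀ k θ).snd) atTop (𝓝 (xStar f θ)) :=
    (tendsto_add_atTop_iff_nat 1).1 hx
  have hty : Tendsto y atTop (𝓝 (xStar f θ)) := by
    have := hx.add (hlim.b_tendsto.smul (hx.sub hz))
    rwa [sub_self, smul_zero, add_zero] at this
  have htdG : Tendsto (fun k => dG (y k)) atTop (𝓝 (dG (xStar f θ))) :=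
    (hf.continuousAt_fderiv_gradX hΘ hθ (xStar f θ)).tendsto.comp
      (hty.prodMk_nhds tendsto_const_nhds)
  have htA : Tendsto (fun k => A (y k)) atTop (𝓝 (A (xStar f θ))) :=
    tendsto_clm_comp htdG tendsto_const_nhds
  have htB : Tendsto (fun k => B (y k)) atTop (𝓝 (B (xStar f θ))) :=
    tendsto_clm_comp htdG tendsto_const_nhds
  have htT : Tendsto (fun k => stepCLM (a k) (b k) (γ k) (A (y k))) atTop (𝓝 T') :=
    tendsto_stepCLM hlim.a_tendsto hlim.b_tendsto hlim.γ_tendsto htA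
  have htN : Tendsto (fun k => stepForcing (γ k) (B (y k))) atTop (𝓝 N') :=
    tendsto_stepForcing hlim.γ_tendsto htB
  obtain ⟨p, hp₀, hp⟩ := exists_norm_stepCLM_pow_lt_one (A := A (xStar f θ)) hL hμ hlim.a_mem.1
    hlim.b_mem hlim.γ_mem.1 (hglob.limit_pos hL hpar hlim)
    (hf.hessian_bounds hΘ hL hθ hμ hconv (hf.hasFDerivAt_gradX_left hΘ hθ _))
  -- The forcing is what remains when `S = T' S + N'` is subtracted from `J (k + 1) = T k J k + N k`
  -- and the right-hand side is written in terms of `J k - S`.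
  refine tendsto_zero_of_linear_recursion
    (e := fun k => (stepCLM (a k) (b k) (γ k) (A (y k)) - T').comp S
      + (stepForcing (γ k) (B (y k)) - N')) htT hp₀ hp ?_ fun k => ?_
  · have h1 : Tendsto (fun k => (stepCLM (a k) (b k) (γ k) (A (y k)) - T').comp S) atTop
        (𝓝 ((T' - T').comp S)) :=
      tendsto_clm_comp (htT.sub_const T') tendsto_const_nhds
    have h2 := h1.add (htN.sub_const N')
    rwa [sub_self, sub_self, ContinuousLinearMap.zero_comp, add_zero] at h2
  · have h1 : fderiv ℝ (iter f a b γ X₀ (k + 1)) θ =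
        (stepCLM (a k) (b k) (γ k) (A (y k))).comp (fderiv ℝ (iter f a b γ X₀ k) θ)
          + stepForcing (γ k) (B (y k)) :=
      (hasFDerivAt_step (differentiableAt_iter hΘ hf a b γ hX₀ hθ k).hasFDerivAt
        (hG (y k))).fderiv
    rw [h1, ContinuousLinearMap.comp_sub, ContinuousLinearMap.sub_comp]
    nth_rewrite 1 [hstar]
    abel

end Derivatives

end InertialMethod

theorem mainTheorem3 {n m : ℕ} (f : Euc n → Euc m → ℝ) (Θ : Set (Euc m)) (hΘ : IsOpen Θ)
    (L : ℝ) (hL : 0 < L)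
    (hf : InertialMethod.SmoothObjective f Θ L)
    (hconv : ∀ θ ∈ Θ, ∃ μ > 0, StrongConvexOn Set.univ μ (fun x => f x θ))
    (a b γ : ℕ → ℝ) (hpar : InertialMethod.AdmissibleParams a b γ L)
    (hglob : InertialMethod.GlobalCondition a b γ L)
    (a' b' γ' : ℝ) (hlim : InertialMethod.ParamLimits a b γ L a' b' γ')
    (X₀ : Euc m → Euc2 n) (hX₀ : ContDiffOn ℝ 1 X₀ Θ)
    (θ : Euc m) (hθ : θ ∈ Θ)
    (heig : a' < 1 → b' < 1 → (2 * (b' - a') - 1) / (1 + 2 * b') <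
      InertialMethod.smallestEigenvalue (InertialMethod.opG f γ' θ)) :
    (∀ x, IsMinOn (fun y => f y θ) Set.univ x ↔ x = InertialMethod.xStar f θ) ∧
    (∀ k, DifferentiableAt ℝ (InertialMethod.iter f a b γ X₀ k) θ) ∧
    DifferentiableAt ℝ (InertialMethod.XStar f) θ ∧
    ∀ ε > 0, ∃ K : ℕ, ∀ k ≥ K,
      ‖fderiv ℝ (InertialMethod.iter f a b γ X₀ (k + 1)) θ
          - fderiv ℝ (InertialMethod.XStar f) θ‖ ≤
        (2 * InertialMethod.specRadius (InertialMethod.limitMatrix f a' b' γ' θ)) ^ (k + 1 - K) *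
            ‖fderiv ℝ (InertialMethod.iter f a b γ X₀ K) θ
              - fderiv ℝ (InertialMethod.XStar f) θ‖
          + ε * ∑ i ∈ Finset.Icc K k,
              (2 * InertialMethod.specRadius
                (InertialMethod.limitMatrix f a' b' γ' θ)) ^ (i - K) *
              (2 + ‖fderiv ℝ (InertialMethod.iter f a b γ X₀ i) θ
                - fderiv ℝ (InertialMethod.XStar f) θ‖) := by
  obtain ⟨μ, hμ, hsc⟩ := hconv θ hθ
  refine ⟨hf.isMinOn_iff_eq_xStar hΘ hθ hμ hsc,
    InertialMethod.differentiableAt_iter hΘ hf a b γ hX₀ hθ,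
    InertialMethod.differentiableAt_XStar hΘ hL hf hθ hμ hsc, fun ε hε => ?_⟩
  have hlim0 :=
    (InertialMethod.tendsto_fderiv_iter hΘ hL hf hpar hglob hlim hX₀ hθ hμ hsc).norm
  rw [norm_zero] at hlim0
  -- The threshold is 2ε because the summand `i = K` equals `2 + ‖…‖`, with `τ ^ 0 = 1`.
  obtain ⟨K, hK⟩ := eventually_atTop.1 (hlim0.eventually (gt_mem_nhds (mul_pos hε two_pos)))
  refine ⟨K, fun k hk => ?_⟩
  set τ := 2 * InertialMethod.specRadius (InertialMethod.limitMatrix f a' b' γ' θ) with hτ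
  have hτ0 : 0 ≤ τ := mul_nonneg two_pos.le ENNReal.toReal_nonneg
  have hsum := Finset.single_le_sum (s := Finset.Icc K k)
    (f := fun i => τ ^ (i - K) * (2 + ‖fderiv ℝ (InertialMethod.iter f a b γ X₀ i) θ
      - fderiv ℝ (InertialMethod.XStar f) θ‖))
    (fun i _ => by positivity) (Finset.left_mem_Icc.2 hk)
  simp only [Nat.sub_self, pow_zero, one_mul] at hsum
  have h2 : (2 : ℝ) ≤ ∑ i ∈ Finset.Icc K k, τ ^ (i - K) *
      (2 + ‖fderiv ℝ (InertialMethod.iter f a b γ X₀ i) θ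
        - fderiv ℝ (InertialMethod.XStar f) θ‖) :=
    le_trans (le_add_of_nonneg_right (norm_nonneg _)) hsum
  calc _ ≤ ε * 2 := (hK (k + 1) (by omega)).le
    _ ≤ ε * _ := mul_le_mul_of_nonneg_left h2 hε.le
    _ ≤ _ := le_add_of_nonneg_left (mul_nonneg (pow_nonneg hτ0 _) (norm_nonneg _))
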